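/- An $L$-algebra is a set $X$ with a binary operation $(x,y)\mapsto x\cdot y$ such that: there is an element $e\in X$ (the logical unit, necessarily unique) with $e\cdot x=x$ and $x\cdot e=x\cdot x=e$ for all $x$; $(x\cdot y)\cdot(x\cdot z)=(y\cdot x)\cdot(y\cdot z)$ for all $x,y,z$; and $x\cdot y=y\cdot x=e$ implies $x=y$. It is partially ordered by $x\le y\iff x\cdot y=e$. An isomorphism of $L$-algebras is a bijection that preserves the operation. An $L$-algebra $X$ is regular if $$\bigl((x\cdot y)\cdot z\bigr)\cdot\bigl((y\cdot x)\cdot z\bigr)=\bigl((x\cdot y)\cdot z\bigr)\cdot z\qquad\text{for all }x,y,z\in X,$$ and for all $x\le y$ in $X$ there exists $z\ge x$ with $z\cdot x=y$. Let $\mathbb Z^\omega=\bigoplus_{i=1}^\infty\mathbb Z$, with coordinatewise addition, order and lattice operations, and let $(\mathbb Z^\omega)^-=\{g\in\mathbb Z^\omega: g\le 0\}$ be its negative cone, which is an $L$-algebra under $x\cdot y=(x\wedge y)-x$. An infinite-dimensional Young diagram is a finite, non-empty subset of $(\mathbb Z^\omega)^-$ that is upwards-closed in $(\mathbb Z^\omega)^-$;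 it is closed under this operation, and is therefore regarded as an $L$-algebra by restriction. Two such diagrams are conjugate if a permutation of the coordinates of $\mathbb Z^\omega$ carries one onto the other. **Theorem.** Every infinite-dimensional Young diagram is a finite regular $L$-algebra, and sending a diagram to its isomorphism class as an $L$-algebra induces a well-defined bijection from the set of conjugacy classes of infinite-dimensional Young diagrams onto the set of isomorphism classes of finite regular $L$-algebras. -/

import Mathlib

universe u v

/-- An `L`-algebra: a set with a binary operation `x ⇀ y` (the product `x · y`) and a
logical unit `e`. The unit is determined by the operation, since `x ⇀ x = e`. -/
class LAlgebra (X : Type u) where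
  op : X → X → X
  e : X
  e_op : ∀ x, op e x = x
  op_e : ∀ x, op x e = e
  op_self : ∀ x, op x x = e
  cycle : ∀ x y z, op (op x y) (op x z) = op (op y x) (op y z)
  antisymm : ∀ x y, op x y = e → op y x = e → x = y

namespace LAlgebra

infix:70 " ⇀ " => LAlgebra.op

/-- The natural order of an `L`-algebra: `x ≤ y` if and only if `x ⇀ y = e`. -/
def NatLE {X : Type u} [LAlgebra X] (x y : X) : Prop := x ⇀ y = e

/-- Semiregular `L`-algebras. -/
def IsSemiregular (X : Type u) [LAlgebra X] : Prop :=
  ∀ x y z : X, ((x ⇀ y) ⇀ z) ⇀ ((y ⇀ x) ⇀ z) = ((x ⇀ y) ⇀ z) ⇀ z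

/-- Regular `L`-algebras: semiregular, and whenever `x ≤ y` there is `z ≥ x` with
`z ⇀ x = y`. -/
def IsRegular (X : Type u) [LAlgebra X] : Prop :=
  IsSemiregular X ∧ ∀ x y : X, NatLE x y → ∃ z : X, NatLE x z ∧ z ⇀ x = y

/-- Two `L`-algebras are isomorphic if there is a bijection preserving the operation. -/
def Isomorphic (X : Type u) (Y : Type v) [LAlgebra X] [LAlgebra Y] : Prop :=
  ∃ f : X ≃ Y, ∀ x y : X, f (x ⇀ y) = f x ⇀ f y

end LAlgebra

/-- Finite regular `L`-algebras. -/
structure FiniteRegularLAlgebra where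
  carrier : Type u
  [lalgebra : LAlgebra carrier]
  finite : Finite carrier
  regular : LAlgebra.IsRegular carrier

namespace FiniteRegularLAlgebra

instance (X : FiniteRegularLAlgebra.{u}) : LAlgebra X.carrier := X.lalgebra

/-- Isomorphism of finite regular `L`-algebras, as an equivalence relation. -/
instance isoSetoid : Setoid FiniteRegularLAlgebra.{u} where
  r X Y := LAlgebra.Isomorphic X.carrier Y.carrier
  iseqv :=
    { refl := fun _ => ⟨Equiv.refl _, fun _ _ => rfl⟩
      symm := by
        rintro X Y ⟨f, hf⟩
        refine ⟨f.symm, fun x y => ?_⟩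
        apply f.injective
        simp [hf]
      trans := by
        rintro X Y Z ⟨f, hf⟩ ⟨g, hg⟩
        exact ⟨f.trans g, fun x y => by simp [hf, hg]⟩ }

/-- The isomorphism classes of finite regular `L`-algebras. -/
def IsoClass : Type (u + 1) := Quotient isoSetoid.{u}

end FiniteRegularLAlgebra

/-- The `ℓ`-group `ℤ^ω`, the direct sum of countably many copies of `ℤ` with the
coordinatewise group and lattice operations. -/
abbrev ZOmega : Type := ℕ →₀ ℤ

/-- The negative cone `{g : g ≤ 0}` of `ℤ^ω`. -/
abbrev ZOmega.NegCone : Type := {g : ZOmega // g ≤ 0}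

namespace ZOmega.NegCone

/-- The operation `x · y = (x ∧ y) x⁻¹` on the negative cone, in additive notation. -/
noncomputable def op (x y : NegCone) : NegCone :=
  ⟨x.1 ⊓ y.1 - x.1, sub_nonpos.2 inf_le_left⟩

theorem op_apply (x y : NegCone) (i : ℕ) : (op x y).1 i = min (x.1 i) (y.1 i) - x.1 i := by
  simp [op]

theorem apply_nonpos (x : NegCone) (i : ℕ) : x.1 i ≤ 0 := by
  simpa using x.2 i

theorem le_op (x y : NegCone) : y ≤ op x y := by
  intro i
  have h1 := op_apply x y i
  have h2 := apply_nonpos x i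
  have h3 := apply_nonpos y i
  show y.1 i ≤ (op x y).1 i
  omega

/-- The canonical `L`-algebra structure on the negative cone of `ℤ^ω`. -/
noncomputable instance : LAlgebra NegCone where
  op := op
  e := ⟨0, le_refl 0⟩
  e_op x := by
    ext i
    have := apply_nonpos x i
    simp only [op_apply, Finsupp.coe_zero, Pi.zero_apply]
    omega
  op_e x := by
    ext i
    have := apply_nonpos x i
    simp only [op_apply, Finsupp.coe_zero, Pi.zero_apply]
    omega
  op_self x := by
    ext i
    simp only [op_apply, Finsupp.coe_zero, Pi.zero_apply]
    omega
  cycle x y z := by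
    ext i
    simp only [op_apply]
    omega
  antisymm x y h1 h2 := by
    ext i
    have h3 : (op x y).1 i = 0 := by rw [h1]; rfl
    have h4 : (op y x).1 i = 0 := by rw [h2]; rfl
    rw [op_apply] at h3 h4
    omega

end ZOmega.NegCone

/-- An infinite-dimensional Young diagram: a finite, non-empty, upwards-closed subset of
the negative cone of `ℤ^ω`. -/
structure InfYoungDiagram where
  cells : Set ZOmega.NegCone
  finite : cells.Finite
  nonempty : cells.Nonempty
  upward : IsUpperSet cells

namespace InfYoungDiagram

open ZOmega

theorem op_mem (D : InfYoungDiagram) (x y : NegCone) (hy : y ∈ D.cells) :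
    x ⇀ y ∈ D.cells :=
  D.upward (NegCone.le_op x y) hy

theorem e_mem (D : InfYoungDiagram) : (LAlgebra.e : NegCone) ∈ D.cells := by
  obtain ⟨x, hx⟩ := D.nonempty
  exact D.upward x.2 hx

/-- The `L`-algebra structure on a diagram, restricted from the negative cone. -/
noncomputable instance (D : InfYoungDiagram) : LAlgebra D.cells where
  op x y := ⟨x.1 ⇀ y.1, D.op_mem x.1 y.1 y.2⟩
  e := ⟨LAlgebra.e, D.e_mem⟩
  e_op x := Subtype.ext (LAlgebra.e_op x.1)
  op_e x := Subtype.ext (LAlgebra.op_e x.1)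
  op_self x := Subtype.ext (LAlgebra.op_self x.1)
  cycle x y z := Subtype.ext (LAlgebra.cycle x.1 y.1 z.1)
  antisymm x y h1 h2 :=
    Subtype.ext (LAlgebra.antisymm x.1 y.1 (congrArg Subtype.val h1) (congrArg Subtype.val h2))

/-- Two diagrams are conjugate if some permutation `σ` of the coordinates of `ℤ^ω` carries
one onto the other; here `Finsupp.equivMapDomain σ x` is `x` with its coordinates permuted. -/
def Conjugate (D E : InfYoungDiagram) : Prop :=
  ∃ σ : Equiv.Perm ℕ,
    Finsupp.equivMapDomain σ '' (Subtype.val '' D.cells) = (Subtype.val '' E.cells : Set ZOmega)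

/-- Conjugacy of diagrams, as an equivalence relation. -/
instance conjSetoid : Setoid InfYoungDiagram where
  r := Conjugate
  iseqv :=
    { refl := fun D => ⟨Equiv.refl ℕ, by
        have : (Finsupp.equivMapDomain (Equiv.refl ℕ) : ZOmega → ZOmega) = id :=
          funext fun x => Finsupp.equivMapDomain_refl x
        rw [this, Set.image_id]⟩
      symm := by
        rintro D E ⟨σ, h⟩
        refine ⟨σ.symm, ?_⟩
        rw [← h, Set.image_image]
        have : (fun x : ZOmega => Finsupp.equivMapDomain σ.symm (Finsupp.equivMapDomain σ x))
            = id := by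
          funext x
          ext i
          simp
        rw [this, Set.image_id]
      trans := by
        rintro D E F ⟨σ, h⟩ ⟨τ, k⟩
        refine ⟨σ.trans τ, ?_⟩
        rw [← k, ← h, Set.image_image (Finsupp.equivMapDomain τ)]
        have : (Finsupp.equivMapDomain (σ.trans τ) : ZOmega → ZOmega) =
            fun x => Finsupp.equivMapDomain τ (Finsupp.equivMapDomain σ x) :=
          funext fun x => Finsupp.equivMapDomain_trans σ τ x
        rw [this] }

/-- The conjugacy classes of infinite-dimensional Young diagrams. -/
def ConjClass : Type := Quotient conjSetoid

end InfYoungDiagram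

/-!
# Finite regular `L`-algebras are Young diagrams

Negating coordinates turns the operation `x ⇀ y` of the negative cone of `ℤ^ω` into truncated
subtraction `y - x`, from which regularity of a diagram is read off coordinatewise.

Conversely, let `X` be a finite regular `L`-algebra with its natural order, whose largest element
is `e`. The role of the generators of `ℤ^ω` is played by the coatoms of `X`. For `x` fixed,
regularity says that the antitone map `y ↦ y ⇀ x` of the finite interval `[x, e]` to itself is
surjective, hence an anti-automorphism (`LAlgebra.IsRegular.le_of_op_le_op`); in particular the
minimal elements strictly above `x` are the `a ⇀ x` with `a` a coatom above `x`. The maps `a ⇀ ·`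
for coatoms `a` commute (`LAlgebra.IsSemiregular.op_op_comm`), and `a ⇀ x = x` unless `x ≤ a`
(`LAlgebra.IsRegular.op_eq_of_not_le`). So an element `x` is described by the multiplicities
`LAlgebra.mult a x`, the numbers of steps that each coatom `a` can effectively be applied to `x`.
The map `a ⇀ ·` lowers the multiplicity of `a` by one and leaves the others unchanged. As
`x ⇀ y = (a ⇀ x) ⇀ (a ⇀ y)` for `x ≤ a`, downward induction shows that the multiplicities turn the
operation into truncated subtraction (`LAlgebra.IsRegular.mult_op`), determine `x`, and have as
their range a downward closed set (`LAlgebra.IsRegular.exists_mult_eq`). Their negatives identify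
`X` with a diagram (`InfYoungDiagram.exists_isomorphic`).

Finally, the coatoms of a diagram are its unit cells, with a single entry `-1`, and the coordinate
`i` of a cell is again the number of effective applications of the `i`-th unit cell. Hence an
isomorphism of diagrams permutes the finitely many coordinates that occur, and this bijection
between finite subsets of `ℕ` extends to a permutation of `ℕ`
(`InfYoungDiagram.conjugate_of_isomorphic`).
-/

namespace LAlgebra

/-! ### The natural order -/

section Order

variable {X : Type u} [LAlgebra X]

variable (X) in
/-- The natural order of an `L`-algebra as a partial order. It is an instance only in
this section, because the negative cone of `ℤ^ω` already carries its pointwise order. -/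
abbrev natOrder : PartialOrder X where
  le := NatLE
  le_refl := op_self
  le_trans x y z hxy hyz := by
    have h := cycle x y z
    rw [show x ⇀ y = e from hxy, show y ⇀ z = e from hyz, e_op, op_e] at h
    exact h
  le_antisymm := antisymm

attribute [local instance] natOrder

variable (X) in
/-- The logical unit is the largest element of the natural order. -/
abbrev natOrderTop : OrderTop X where
  top := e
  le_top := op_e

attribute [local instance] natOrderTop

theorem le_iff_op_eq {x y : X} : x ≤ y ↔ x ⇀ y = e := Iff.rfl

theorem top_eq : (⊤ : X) = e := rfl

/-- Multiplying by a smaller element can be done in two steps. -/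
theorem op_eq_op_op_of_le {x y : X} (h : x ≤ y) (z : X) : x ⇀ z = (y ⇀ x) ⇀ (y ⇀ z) := by
  rw [← cycle, le_iff_op_eq.1 h, e_op]

theorem IsSemiregular.le_op (hX : IsSemiregular X) (x z : X) : z ≤ x ⇀ z := by
  have h := hX x e z
  rwa [e_op, op_e, e_op, op_self] at h

theorem IsSemiregular.op_le_op_right (hX : IsSemiregular X) {x y : X} (h : x ≤ y) (z : X) :
    y ⇀ z ≤ x ⇀ z := by
  rw [op_eq_op_op_of_le h]
  exact hX.le_op _ _

/-- On the finite interval above `x`, the antitone map `y ↦ y ⇀ x` is surjective by regularity,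
so it is bijective, and an antitone bijection of a finite poset onto itself reflects the order. -/
theorem IsRegular.le_of_op_le_op [Finite X] (hX : IsRegular X) {x y z : X} (hy : x ≤ y)
    (hz : x ≤ z) (h : y ⇀ x ≤ z ⇀ x) : z ≤ y := by
  let ψ : Set.Ici x → Set.Ici x := fun y => ⟨y.1 ⇀ x, hX.1.le_op _ _⟩
  have hs : Function.Surjective ψ := by
    rintro ⟨w, hw⟩
    obtain ⟨v, hv, rfl⟩ := hX.2 x w hw
    exact ⟨⟨v, hv⟩, rfl⟩
  have hi : Function.Injective ψ := Finite.injective_iff_surjective.2 hs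
  -- `ψ` acts injectively on the finite set of comparable pairs, hence surjectively.
  let P := {p : Set.Ici x × Set.Ici x // p.1 ≤ p.2}
  let Ψ : P → P := fun p => ⟨(ψ p.1.2, ψ p.1.1), hX.1.op_le_op_right p.2 x⟩
  have hΨ : Function.Injective Ψ := by
    rintro ⟨⟨a, b⟩, _⟩ ⟨⟨c, d⟩, _⟩ hab
    have h' := Prod.ext_iff.1 (congrArg Subtype.val hab)
    exact Subtype.ext (Prod.ext (hi h'.2) (hi h'.1))
  obtain ⟨⟨⟨a, b⟩, hab⟩, hp⟩ :=
    (Finite.injective_iff_surjective.1 hΨ) ⟨(ψ ⟨y, hy⟩, ψ ⟨z, hz⟩), h⟩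
  have h' := Prod.ext_iff.1 (congrArg Subtype.val hp)
  have hb : b = ⟨y, hy⟩ := hi h'.1
  have ha : a = ⟨z, hz⟩ := hi h'.2
  subst ha hb
  exact hab

/-! ### Multiplication by coatoms -/

theorem IsSemiregular.op_eq_self_or_eq_top (hX : IsSemiregular X) {a : X} (ha : IsCoatom a)
    (x : X) : x ⇀ a = a ∨ x ⇀ a = e := by
  rcases (hX.le_op x a).eq_or_lt with h | h
  · exact Or.inl h.symm
  · exact Or.inr (ha.2 _ h)

theorem IsSemiregular.op_eq_right_of_not_le (hX : IsSemiregular X) {a x : X} (ha : IsCoatom a)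
    (h : ¬ x ≤ a) : x ⇀ a = a :=
  (hX.op_eq_self_or_eq_top ha x).resolve_right h

theorem not_le_of_isCoatom {a b : X} (ha : IsCoatom a) (hb : IsCoatom b) (h : a ≠ b) :
    ¬ a ≤ b :=
  fun hab => hb.1 (ha.2 _ (lt_of_le_of_ne hab h))

theorem IsSemiregular.op_op_comm (hX : IsSemiregular X) {a b : X} (ha : IsCoatom a)
    (hb : IsCoatom b) (x : X) : a ⇀ (b ⇀ x) = b ⇀ (a ⇀ x) := by
  rcases eq_or_ne a b with rfl | h
  · rfl
  have hab := hX.op_eq_right_of_not_le hb (not_le_of_isCoatom ha hb h)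
  have hba := hX.op_eq_right_of_not_le ha (not_le_of_isCoatom hb ha h.symm)
  have := cycle a b x
  rw [hab, hba] at this
  exact this.symm

/-- The multiplicity of `a` in `x`: the number of times `a ⇀ ·` can be applied to `x` before the
result is no longer below `a`. It is the junk value `0` if this never happens. -/
noncomputable def mult (a x : X) : ℕ := sInf {n | ¬ (a ⇀ ·)^[n] x ≤ a}

theorem mult_of_not_le {a x : X} (h : ¬ x ≤ a) : mult a x = 0 :=
  Nat.sInf_eq_zero.2 (Or.inl h)

variable [Finite X]

theorem IsRegular.lt_op (hX : IsRegular X) {a x : X} (ha : IsCoatom a) (h : x ≤ a) :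
    x < a ⇀ x := by
  refine lt_of_le_of_ne (hX.1.le_op _ _) fun heq => ha.1 (top_le_iff.1 ?_)
  refine hX.le_of_op_le_op h le_top ?_
  rw [← heq, top_eq, e_op]

/-- Above `x`, the minimal elements are the `a ⇀ x` with `a` a coatom above `x`. -/
theorem IsRegular.eq_or_eq_of_le_op (hX : IsRegular X) {a x y : X} (ha : IsCoatom a)
    (h : x ≤ a) (hxy : x ≤ y) (hy : y ≤ a ⇀ x) : y = x ∨ y = a ⇀ x := by
  obtain ⟨z, hz, rfl⟩ := hX.2 x y hxy
  rcases (hX.le_of_op_le_op hz h hy).eq_or_lt with rfl | hlt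
  · exact Or.inr rfl
  · rw [ha.2 _ hlt, top_eq, e_op]
    exact Or.inl rfl

theorem IsRegular.eq_of_op_eq (hX : IsRegular X) {a b x : X} (ha : x ≤ a) (hb : x ≤ b)
    (h : a ⇀ x = b ⇀ x) : a = b :=
  le_antisymm (hX.le_of_op_le_op hb ha h.ge) (hX.le_of_op_le_op ha hb h.le)

theorem exists_isCoatom_ge {x : X} (h : x ≠ e) : ∃ a, IsCoatom a ∧ x ≤ a :=
  (eq_top_or_exists_le_coatom x).resolve_left h

/-- A coatom `a` that is not above `x` acts trivially on `x`. By downward induction: otherwise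
`a ⇀ x` lies above some minimal `b ⇀ x`, commutation forces `a ⇀ x = b ⇀ x`, and the
semiregularity equation for `a` and `b` contradicts this. -/
theorem IsRegular.op_eq_of_not_le (hX : IsRegular X) {a x : X} (ha : IsCoatom a)
    (h : ¬ x ≤ a) : a ⇀ x = x := by
  induction x using WellFoundedGT.induction with
  | _ x ih =>
  by_contra hne
  have hlt : x < a ⇀ x := lt_of_le_of_ne (hX.1.le_op _ _) (Ne.symm hne)
  -- The coatom `b` is chosen above the `z ≥ x` with `z ⇀ x = a ⇀ x`.
  obtain ⟨z, hz, hzx⟩ := hX.2 x (a ⇀ x) hlt.le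
  have hze : z ≠ e := by
    rintro rfl
    rw [e_op] at hzx
    exact hlt.ne hzx
  obtain ⟨b, hb, hzb⟩ := exists_isCoatom_ge hze
  have hxb : x ≤ b := le_trans hz hzb
  have hba : b ⇀ x ≤ a ⇀ x := hzx ▸ hX.1.op_le_op_right hzb x
  have hab : a ≠ b := fun hab => h (hab ▸ hxb)
  have hbx := hX.lt_op hb hxb
  have hfix : a ⇀ (b ⇀ x) = b ⇀ x := ih _ hbx fun h' => h (hbx.le.trans h')
  have hle : a ⇀ x ≤ b ⇀ x := by
    rw [← hfix, hX.1.op_op_comm ha hb]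
    exact hX.1.le_op _ _
  have heq : a ⇀ x = b ⇀ x := le_antisymm hle hba
  have hs := hX.1 b a x
  rw [hX.1.op_eq_right_of_not_le ha (not_le_of_isCoatom hb ha hab.symm),
    hX.1.op_eq_right_of_not_le hb (not_le_of_isCoatom ha hb hab), heq, op_self] at hs
  exact hbx.not_ge hs.symm

theorem IsRegular.op_le_iff (hX : IsRegular X) {a b x : X} (ha : IsCoatom a)
    (hb : IsCoatom b) (hab : a ≠ b) : a ⇀ x ≤ b ↔ x ≤ b := by
  refine ⟨(hX.1.le_op a x).trans, fun hxb => ?_⟩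
  by_contra hn
  by_cases hxa : x ≤ a
  · have h1 : b ⇀ x ≤ a ⇀ x := by
      rw [← hX.op_eq_of_not_le hb hn, ← hX.1.op_op_comm ha hb]
      exact hX.1.le_op _ _
    rcases hX.eq_or_eq_of_le_op ha hxa (hX.1.le_op b x) h1 with h2 | h2
    · exact (hX.lt_op hb hxb).ne' h2
    · exact hab (hX.eq_of_op_eq hxa hxb h2.symm)
  · exact hn (by rwa [hX.op_eq_of_not_le ha hxa])

/-! ### Multiplicities of coatoms -/

theorem IsRegular.exists_iterate_not_le (hX : IsRegular X) {a : X} (ha : IsCoatom a) (x : X) :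
    ∃ n, ¬ (a ⇀ ·)^[n] x ≤ a := by
  induction x using WellFoundedGT.induction with
  | _ x ih =>
  by_cases h : x ≤ a
  · obtain ⟨n, hn⟩ := ih _ (hX.lt_op ha h)
    exact ⟨n + 1, hn⟩
  · exact ⟨0, h⟩

theorem IsRegular.mult_of_le (hX : IsRegular X) {a x : X} (ha : IsCoatom a) (h : x ≤ a) :
    mult a x = mult a (a ⇀ x) + 1 := by
  have hpos : 1 ≤ sInf {n | ¬ (a ⇀ ·)^[n] x ≤ a} := by
    rw [Nat.one_le_iff_ne_zero, Ne, Nat.sInf_eq_zero, not_or]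
    exact ⟨fun h0 => h0 h, Set.nonempty_iff_ne_empty.1 (hX.exists_iterate_not_le ha x)⟩
  exact (Nat.sInf_add hpos).symm

theorem IsRegular.mult_pos_iff (hX : IsRegular X) {a x : X} (ha : IsCoatom a) :
    0 < mult a x ↔ x ≤ a := by
  refine ⟨fun h => ?_, fun h => ?_⟩
  · by_contra hn
    exact h.ne' (mult_of_not_le hn)
  · rw [hX.mult_of_le ha h]
    exact Nat.succ_pos _

theorem IsRegular.mult_op_self (hX : IsRegular X) {a : X} (ha : IsCoatom a) (x : X) :
    mult a (a ⇀ x) = mult a x - 1 := by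
  by_cases h : x ≤ a
  · rw [hX.mult_of_le ha h, Nat.add_sub_cancel]
  · rw [hX.op_eq_of_not_le ha h, mult_of_not_le h]

theorem IsRegular.mult_op_of_ne (hX : IsRegular X) {a b : X} (ha : IsCoatom a)
    (hb : IsCoatom b) (hab : a ≠ b) (x : X) : mult b (a ⇀ x) = mult b x := by
  induction x using WellFoundedGT.induction with
  | _ x ih =>
  by_cases h : x ≤ b
  · rw [hX.mult_of_le hb h, hX.mult_of_le hb ((hX.op_le_iff ha hb hab).2 h),
      hX.1.op_op_comm hb ha, ih _ (hX.lt_op hb h)]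
  · rw [mult_of_not_le h, mult_of_not_le ((hX.op_le_iff ha hb hab).not.2 h)]

/-- In terms of multiplicities the operation is truncated subtraction. -/
theorem IsRegular.mult_op (hX : IsRegular X) {b : X} (hb : IsCoatom b) (x y : X) :
    mult b (x ⇀ y) = mult b y - mult b x := by
  induction x using WellFoundedGT.induction generalizing y with
  | _ x ih =>
  by_cases hx : x = e
  · subst hx
    rw [e_op, mult_of_not_le (x := (e : X)) fun h => hb.1 (top_le_iff.1 h), Nat.sub_zero]
  obtain ⟨a, ha, hxa⟩ := exists_isCoatom_ge hx
  rw [op_eq_op_op_of_le hxa, ih _ (hX.lt_op ha hxa)]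
  rcases eq_or_ne a b with rfl | hab
  · have := (hX.mult_pos_iff ha).2 hxa
    rw [hX.mult_op_self ha, hX.mult_op_self ha]
    omega
  · rw [hX.mult_op_of_ne ha hb hab, hX.mult_op_of_ne ha hb hab]

theorem IsRegular.le_of_mult_le (hX : IsRegular X) {x y : X}
    (h : ∀ a, IsCoatom a → mult a y ≤ mult a x) : x ≤ y := by
  rw [le_iff_op_eq]
  by_contra hne
  obtain ⟨a, ha, hle⟩ := exists_isCoatom_ge hne
  have h1 := (hX.mult_pos_iff ha).2 hle
  rw [hX.mult_op ha] at h1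
  have := h a ha
  omega

theorem IsRegular.eq_of_mult_eq (hX : IsRegular X) {x y : X}
    (h : ∀ a, IsCoatom a → mult a x = mult a y) : x = y :=
  le_antisymm (hX.le_of_mult_le fun a ha => (h a ha).ge) (hX.le_of_mult_le fun a ha => (h a ha).le)

/-- Every multiplicity function bounded by that of an element is realized: as long as `x` has
some multiplicity too large, it is lowered by one by applying the coatom. -/
theorem IsRegular.exists_mult_eq (hX : IsRegular X) (m : X → ℕ) (x : X)
    (h : ∀ a, IsCoatom a → m a ≤ mult a x) : ∃ y : X, ∀ a, IsCoatom a → mult a y = m a := by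
  induction x using WellFoundedGT.induction with
  | _ x ih =>
  by_cases hx : ∀ a, IsCoatom a → mult a x = m a
  · exact ⟨x, hx⟩
  push Not at hx
  obtain ⟨a, ha, hne⟩ := hx
  have hlt : m a < mult a x := lt_of_le_of_ne (h a ha) hne.symm
  refine ih _ (hX.lt_op ha ((hX.mult_pos_iff ha).1 (Nat.zero_lt_of_lt hlt))) fun b hb => ?_
  rcases eq_or_ne a b with rfl | hab
  · rw [hX.mult_op_self ha]
    omega
  · rw [hX.mult_op_of_ne ha hb hab]
    exact h b hb

end Order

end LAlgebra

/-! ### Transport along isomorphisms -/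

namespace LAlgebra

theorem map_e_of_map_op {X : Type u} {Y : Type v} [LAlgebra X] [LAlgebra Y] (f : X ≃ Y)
    (hf : ∀ x y : X, f (x ⇀ y) = f x ⇀ f y) : f e = e := by
  rw [← op_self (e : X), hf, op_self]

theorem Isomorphic.symm {X : Type u} {Y : Type v} [LAlgebra X] [LAlgebra Y]
    (h : Isomorphic X Y) : Isomorphic Y X := by
  obtain ⟨f, hf⟩ := h
  exact ⟨f.symm, fun x y => f.injective (by simp [hf])⟩

theorem Isomorphic.trans {X : Type*} {Y : Type*} {Z : Type*} [LAlgebra X] [LAlgebra Y]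
    [LAlgebra Z] (h : Isomorphic X Y) (k : Isomorphic Y Z) : Isomorphic X Z := by
  obtain ⟨f, hf⟩ := h
  obtain ⟨g, hg⟩ := k
  exact ⟨f.trans g, fun x y => by simp [hf, hg]⟩

/-- The lift of an `L`-algebra to a larger universe. -/
instance instULift {X : Type v} [LAlgebra X] : LAlgebra (ULift.{u} X) where
  op x y := ⟨x.down ⇀ y.down⟩
  e := ⟨e⟩
  e_op x := congrArg ULift.up (e_op x.down)
  op_e x := congrArg ULift.up (op_e x.down)
  op_self x := congrArg ULift.up (op_self x.down)
  cycle x y z := congrArg ULift.up (cycle x.down y.down z.down)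
  antisymm _ _ h1 h2 :=
    ULift.ext _ _ (antisymm _ _ (congrArg ULift.down h1) (congrArg ULift.down h2))

theorem isomorphic_uLift (X : Type v) [LAlgebra X] : Isomorphic (ULift.{u} X) X :=
  ⟨Equiv.ulift, fun _ _ => rfl⟩

theorem IsRegular.uLift {X : Type v} [LAlgebra X] (hX : IsRegular X) :
    IsRegular (ULift.{u} X) := by
  refine ⟨fun x y z => congrArg ULift.up (hX.1 x.down y.down z.down), fun _ _ h => ?_⟩
  obtain ⟨z, hz, hzx⟩ := hX.2 _ _ (congrArg ULift.down h)
  exact ⟨⟨z⟩, congrArg ULift.up hz, congrArg ULift.up hzx⟩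

end LAlgebra

/-! ### Diagrams as finite regular `L`-algebras -/

namespace ZOmega.NegCone

theorem natLE_iff {x y : NegCone} : LAlgebra.NatLE x y ↔ x ≤ y := by
  have key : LAlgebra.NatLE x y ↔ ∀ i, (op x y).1 i = 0 :=
    ⟨fun h i => by rw [show op x y = LAlgebra.e from h]; rfl,
      fun h => Subtype.ext (Finsupp.ext h)⟩
  rw [key]
  simp only [op_apply]
  exact ⟨fun h i => by have := h i; change x.1 i ≤ y.1 i; omega,
    fun h i => by have : x.1 i ≤ y.1 i := h i; omega⟩

end ZOmega.NegCone

namespace InfYoungDiagram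

open ZOmega

theorem op_apply (D : InfYoungDiagram) (x y : D.cells) (i : ℕ) :
    (x ⇀ y).1.1 i = min (x.1.1 i) (y.1.1 i) - x.1.1 i :=
  NegCone.op_apply x.1 y.1 i

theorem e_apply (D : InfYoungDiagram) (i : ℕ) : (LAlgebra.e : D.cells).1.1 i = 0 := rfl

theorem cell_ext {D : InfYoungDiagram} {x y : D.cells} (h : ∀ i, x.1.1 i = y.1.1 i) : x = y :=
  Subtype.ext (Subtype.ext (Finsupp.ext h))

theorem natLE_iff {D : InfYoungDiagram} {x y : D.cells} :
    LAlgebra.NatLE x y ↔ ∀ i, x.1.1 i ≤ y.1.1 i :=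
  (Subtype.ext_iff.trans NegCone.natLE_iff)

theorem isRegular (D : InfYoungDiagram) : LAlgebra.IsRegular D.cells := by
  refine ⟨fun x y z => cell_ext fun i => ?_, fun x y h => ?_⟩
  · have := NegCone.apply_nonpos z.1 i
    simp only [op_apply]
    omega
  · rw [natLE_iff] at h
    -- In the group, the solution of `z · x = y` above `x` is `x - y`.
    have hz : x.1.1 - y.1.1 ≤ 0 := fun i => by
      have := h i
      simp only [Finsupp.coe_sub, Pi.sub_apply, Finsupp.coe_zero, Pi.zero_apply]
      omega
    have hxz : x.1 ≤ ⟨x.1.1 - y.1.1, hz⟩ := fun i => by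
      have := NegCone.apply_nonpos y.1 i
      simp only [Finsupp.coe_sub, Pi.sub_apply]
      omega
    refine ⟨⟨⟨x.1.1 - y.1.1, hz⟩, D.upward hxz x.2⟩, natLE_iff.2 hxz, cell_ext fun i => ?_⟩
    have := NegCone.apply_nonpos y.1 i
    rw [op_apply]
    simp only [Finsupp.coe_sub, Pi.sub_apply]
    omega

/-! ### Every finite regular `L`-algebra is a diagram -/

theorem exists_isomorphic (X : Type u) [LAlgebra X] [Finite X] (hX : LAlgebra.IsRegular X) :
    ∃ D : InfYoungDiagram, LAlgebra.Isomorphic D.cells X := by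
  let _ := LAlgebra.natOrder X
  let _ := LAlgebra.natOrderTop X
  obtain ⟨ι⟩ : Nonempty ({a : X // IsCoatom a} ↪ ℕ) := nonempty_embedding_nat _
  let c (x : X) : ZOmega :=
    Finsupp.embDomain ι (Finsupp.equivFunOnFinite.symm fun a => -(LAlgebra.mult a.1 x : ℤ))
  have c_apply (x : X) (a : {a : X // IsCoatom a}) : c x (ι a) = -(LAlgebra.mult a.1 x : ℤ) := by
    simp [c, Finsupp.embDomain_apply_self]
  have c_notin (x : X) (i : ℕ) (hi : i ∉ Set.range ι) : c x i = 0 :=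
    Finsupp.embDomain_of_notMem_range _ _ _ hi
  have c_nonpos (x : X) : c x ≤ 0 := fun i => by
    by_cases hi : i ∈ Set.range ι
    · obtain ⟨a, rfl⟩ := hi
      rw [c_apply]
      simp
    · rw [c_notin x i hi]
      rfl
  let φ (x : X) : NegCone := ⟨c x, c_nonpos x⟩
  have φ_inj : Function.Injective φ := fun x y h => hX.eq_of_mult_eq fun a ha => by
    have h1 := c_apply x ⟨a, ha⟩
    have h2 := c_apply y ⟨a, ha⟩
    rw [show c x = c y from congrArg Subtype.val h] at h1
    simp only at h1 h2
    omega
  have φ_op (x y : X) : φ (x ⇀ y) = φ x ⇀ φ y := by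
    refine Subtype.ext (Finsupp.ext fun i => ?_)
    refine Eq.trans ?_ (NegCone.op_apply (φ x) (φ y) i).symm
    change c (x ⇀ y) i = min (c x i) (c y i) - c x i
    by_cases hi : i ∈ Set.range ι
    · obtain ⟨a, rfl⟩ := hi
      rw [c_apply, c_apply, c_apply, hX.mult_op a.2]
      omega
    · simp [c_notin _ i hi]
  have φ_upper : IsUpperSet (Set.range φ) := by
    rintro _ g hg ⟨x, rfl⟩
    have hg' (i : ℕ) : c x i ≤ g.1 i := hg i
    classical
    let m (a : X) : ℕ := if ha : IsCoatom a then (g.1 (ι ⟨a, ha⟩)).natAbs else 0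
    have hm (a : {a : X // IsCoatom a}) : (m a.1 : ℤ) = -g.1 (ι a) := by
      have := NegCone.apply_nonpos g (ι a)
      simp only [m, dif_pos a.2, Subtype.coe_eta]
      omega
    obtain ⟨y, hy⟩ := hX.exists_mult_eq m x fun a ha => by
      have h1 := hg' (ι ⟨a, ha⟩)
      have h2 := hm ⟨a, ha⟩
      rw [c_apply] at h1
      simp only at h1 h2
      omega
    refine ⟨y, Subtype.ext (Finsupp.ext fun i => ?_)⟩
    change c y i = g.1 i
    by_cases hi : i ∈ Set.range ι
    · obtain ⟨a, rfl⟩ := hi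
      rw [c_apply, hy a.1 a.2, hm, neg_neg]
    · have h1 := hg' i
      have h2 := NegCone.apply_nonpos g i
      rw [c_notin x i hi] at h1
      rw [c_notin y i hi]
      omega
  obtain ⟨D, hD⟩ : ∃ D : InfYoungDiagram, D.cells = Set.range φ :=
    ⟨⟨Set.range φ, Set.finite_range φ, ⟨φ LAlgebra.e, Set.mem_range_self _⟩, φ_upper⟩, rfl⟩
  exact ⟨D, LAlgebra.Isomorphic.symm
    ⟨(Equiv.ofInjective φ φ_inj).trans (Equiv.setCongr hD.symm),
      fun x y => Subtype.ext (φ_op x y)⟩⟩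

/-! ### Isomorphic diagrams are conjugate -/

/-- The cell with `-1` at the coordinate `i` and `0` elsewhere. -/
noncomputable def unitCell (i : ℕ) : NegCone :=
  ⟨Finsupp.single i (-1), fun j => by
    rw [Finsupp.single_apply]
    split_ifs <;> simp⟩

theorem unitCell_apply (i j : ℕ) : (unitCell i).1 j = if i = j then -1 else 0 :=
  Finsupp.single_apply

theorem unitCell_apply_self (i : ℕ) : (unitCell i).1 i = -1 := by
  rw [unitCell_apply, if_pos rfl]

theorem unitCell_injective : Function.Injective unitCell := fun i j h => by
  by_contra hne
  have h1 := unitCell_apply_self i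
  rw [h, unitCell_apply, if_neg (Ne.symm hne)] at h1
  exact absurd h1 (by norm_num)

/-- The coordinates that occur in a diagram with a nonzero entry. -/
def directions (D : InfYoungDiagram) : Set ℕ := {i | unitCell i ∈ D.cells}

theorem le_unitCell {x : NegCone} {i : ℕ} (h : x.1 i ≠ 0) : x ≤ unitCell i := fun j => by
  have hi := NegCone.apply_nonpos x i
  have hj := NegCone.apply_nonpos x j
  change x.1 j ≤ (unitCell i).1 j
  rw [unitCell_apply]
  split_ifs with hij
  · subst hij
    omega
  · exact hj

theorem apply_eq_zero (D : InfYoungDiagram) (x : D.cells) {i : ℕ} (hi : i ∉ D.directions) :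
    x.1.1 i = 0 := by
  by_contra h
  exact hi (D.upward (le_unitCell h) x.2)

theorem finite_directions (D : InfYoungDiagram) : D.directions.Finite :=
  D.finite.preimage unitCell_injective.injOn

/-- The unit cells of a diagram are exactly its coatoms, which is a property of the `L`-algebra
structure alone. -/
theorem exists_eq_unitCell_iff (D : InfYoungDiagram) (x : D.cells) :
    (∃ i, x.1 = unitCell i) ↔
      x ≠ LAlgebra.e ∧ ∀ y : D.cells, x ⇀ y = LAlgebra.e → y = x ∨ y = LAlgebra.e := by
  constructor
  · rintro ⟨i, hi⟩
    refine ⟨fun h => ?_, fun y hy => ?_⟩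
    · have h1 := unitCell_apply_self i
      rw [← hi, h, e_apply] at h1
      exact absurd h1 (by norm_num)
    · have hle := natLE_iff.1 hy
      rw [hi] at hle
      have hz (j : ℕ) (hj : i ≠ j) : y.1.1 j = 0 := by
        have h1 := hle j
        have h2 := NegCone.apply_nonpos y.1 j
        rw [unitCell_apply, if_neg hj] at h1
        omega
      by_cases h0 : y.1.1 i = 0
      · refine Or.inr (cell_ext fun j => ?_)
        change _ = 0
        rcases eq_or_ne i j with rfl | hj
        · exact h0
        · exact hz j hj
      · refine Or.inl (cell_ext fun j => ?_)
        rw [hi, unitCell_apply]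
        split_ifs with hj
        · subst hj
          have h1 := hle i
          have h2 := NegCone.apply_nonpos y.1 i
          rw [unitCell_apply_self] at h1
          omega
        · exact hz j hj
  · rintro ⟨hne, hmax⟩
    obtain ⟨i, hi⟩ : ∃ i, x.1.1 i ≠ 0 := by
      by_contra! h
      exact hne (cell_ext h)
    have hle := le_unitCell hi
    let w : D.cells := ⟨unitCell i, D.upward hle x.2⟩
    rcases hmax w (natLE_iff.2 hle) with h | h
    · exact ⟨i, congrArg Subtype.val h.symm⟩
    · have h1 := unitCell_apply_self i
      rw [show unitCell i = (LAlgebra.e : D.cells).1 from congrArg Subtype.val h,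
        e_apply] at h1
      exact absurd h1 (by norm_num)

theorem exists_map_unitCell {D E : InfYoungDiagram} (f : D.cells ≃ E.cells)
    (hf : ∀ x y, f (x ⇀ y) = f x ⇀ f y) (i : D.directions) :
    ∃ j : E.directions, f ⟨unitCell i, i.2⟩ = ⟨unitCell j, j.2⟩ := by
  obtain ⟨h1, h2⟩ := (D.exists_eq_unitCell_iff ⟨unitCell i, i.2⟩).1 ⟨i, rfl⟩
  have fe := LAlgebra.map_e_of_map_op f hf
  obtain ⟨j, hj⟩ := (E.exists_eq_unitCell_iff (f ⟨unitCell i, i.2⟩)).2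
    ⟨fun h => h1 (f.injective (h.trans fe.symm)), fun y hy => by
      obtain ⟨z, rfl⟩ := f.surjective y
      rw [← hf, ← fe] at hy
      rw [← fe]
      exact (h2 z (f.injective hy)).imp (congrArg f) (congrArg f)⟩
  exact ⟨⟨j, show unitCell j ∈ E.cells from hj ▸ (f ⟨unitCell i, i.2⟩).2⟩, Subtype.ext hj⟩

theorem exists_directions_equiv {D E : InfYoungDiagram} (f : D.cells ≃ E.cells)
    (hf : ∀ x y, f (x ⇀ y) = f x ⇀ f y) :
    ∃ σ : D.directions ≃ E.directions, ∀ i : D.directions,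
      f ⟨unitCell i, i.2⟩ = ⟨unitCell (σ i), (σ i).2⟩ := by
  choose σ hσ using exists_map_unitCell f hf
  refine ⟨Equiv.ofBijective σ ⟨fun i j h => ?_, fun j => ?_⟩, hσ⟩
  · have h1 : f ⟨unitCell i, i.2⟩ = f ⟨unitCell j, j.2⟩ := by rw [hσ, hσ, h]
    exact Subtype.ext (unitCell_injective (congrArg Subtype.val (f.injective h1)))
  · obtain ⟨i, hi⟩ := exists_map_unitCell f.symm (fun x y => f.injective (by simp [hf])) j
    refine ⟨i, ?_⟩
    rw [Equiv.symm_apply_eq, hσ] at hi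
    exact Subtype.ext (unitCell_injective (congrArg Subtype.val hi)).symm

/-- The coordinate `x i` is the number of times that multiplication by the `i`-th unit cell
changes the cell, so isomorphisms permute coordinates. -/
theorem map_apply {D E : InfYoungDiagram} (f : D.cells ≃ E.cells)
    (hf : ∀ x y, f (x ⇀ y) = f x ⇀ f y) {i j : ℕ} (hi : unitCell i ∈ D.cells)
    (hj : unitCell j ∈ E.cells) (hij : f ⟨unitCell i, hi⟩ = ⟨unitCell j, hj⟩) (x : D.cells) :
    (f x).1.1 j = x.1.1 i := by
  have step (F : InfYoungDiagram) (k : ℕ) (hk : unitCell k ∈ F.cells) (y : F.cells) :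
      ((⟨unitCell k, hk⟩ : F.cells) ⇀ y).1.1 k = min (-1) (y.1.1 k) + 1 := by
    rw [op_apply, unitCell_apply_self, sub_neg_eq_add]
  have fixed (F : InfYoungDiagram) (k : ℕ) (hk : unitCell k ∈ F.cells) (y : F.cells) :
      (⟨unitCell k, hk⟩ : F.cells) ⇀ y = y ↔ y.1.1 k = 0 := by
    constructor
    · intro h
      have h1 := step F k hk y
      have h2 := NegCone.apply_nonpos y.1 k
      rw [h] at h1
      omega
    · intro h
      refine cell_ext fun l => ?_
      have h2 := NegCone.apply_nonpos y.1 l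
      rw [op_apply, unitCell_apply]
      split_ifs with hl
      · subst hl
        rw [h]
        rfl
      · omega
  have zero_iff (y : D.cells) : (f y).1.1 j = 0 ↔ y.1.1 i = 0 := by
    rw [← fixed E j hj, ← fixed D i hi, ← hij, ← hf, f.injective.eq_iff]
  obtain ⟨n, hn⟩ : ∃ n : ℕ, x.1.1 i = -(n : ℤ) :=
    ⟨(x.1.1 i).natAbs, by have := NegCone.apply_nonpos x.1 i; omega⟩
  induction n generalizing x with
  | zero =>
    have h0 : x.1.1 i = 0 := by simpa using hn
    rw [h0, zero_iff, h0]
  | succ n ih =>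
    have h1 := step D i hi x
    have h2 := step E j hj (f x)
    have h3 := ih ((⟨unitCell i, hi⟩ : D.cells) ⇀ x) (by omega)
    have h4 := (zero_iff x).not.2 (by omega)
    have h5 := NegCone.apply_nonpos (f x).1 j
    rw [hf, hij] at h3
    omega

theorem exists_perm_extending {S T : Set ℕ} (hS : S.Finite) (hT : T.Finite) (σ : S ≃ T) :
    ∃ τ : Equiv.Perm ℕ, ∀ i : S, τ i = σ i := by
  classical
  have : Infinite (Sᶜ : Set ℕ) := hS.infinite_compl.to_subtype
  have : Infinite (Tᶜ : Set ℕ) := hT.infinite_compl.to_subtype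
  obtain ⟨ρ⟩ : Nonempty ((Sᶜ : Set ℕ) ≃ (Tᶜ : Set ℕ)) := nonempty_equiv_of_countable
  exact ⟨Equiv.subtypeCongr σ ρ, fun i => by
    simp [Equiv.subtypeCongr, Equiv.sumCompl]⟩

theorem conjugate_of_isomorphic {D E : InfYoungDiagram}
    (h : LAlgebra.Isomorphic D.cells E.cells) : Conjugate D E := by
  obtain ⟨f, hf⟩ := h
  obtain ⟨σ, hσ⟩ := exists_directions_equiv f hf
  obtain ⟨τ, hτ⟩ := exists_perm_extending D.finite_directions E.finite_directions σ
  have key (x : D.cells) : Finsupp.equivMapDomain τ x.1.1 = (f x).1.1 := by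
    ext j
    obtain ⟨i, rfl⟩ := τ.surjective j
    rw [Finsupp.equivMapDomain_apply, τ.symm_apply_apply]
    by_cases hi : i ∈ D.directions
    · rw [hτ ⟨i, hi⟩]
      exact (map_apply f hf hi _ (hσ ⟨i, hi⟩) x).symm
    · have hτi : τ i ∉ E.directions := fun h => hi (by
        have h1 := hτ (σ.symm ⟨τ i, h⟩)
        rw [σ.apply_symm_apply] at h1
        exact τ.injective h1 ▸ (σ.symm ⟨τ i, h⟩).2)
      rw [D.apply_eq_zero x hi, E.apply_eq_zero (f x) hτi]
  refine ⟨τ, Set.Subset.antisymm ?_ ?_⟩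
  · rintro _ ⟨_, ⟨x, hx, rfl⟩, rfl⟩
    exact ⟨(f ⟨x, hx⟩).1, (f ⟨x, hx⟩).2, (key ⟨x, hx⟩).symm⟩
  · rintro _ ⟨y, hy, rfl⟩
    obtain ⟨x, hx⟩ := f.surjective ⟨y, hy⟩
    refine ⟨x.1.1, ⟨x.1, x.2, rfl⟩, ?_⟩
    rw [key, hx]

theorem isomorphic_of_conjugate {D E : InfYoungDiagram} (h : Conjugate D E) :
    LAlgebra.Isomorphic D.cells E.cells := by
  obtain ⟨τ, hτ⟩ := h
  have hmem (x : D.cells) : ∃ y : E.cells, y.1.1 = Finsupp.equivMapDomain τ x.1.1 := by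
    have : Finsupp.equivMapDomain τ x.1.1 ∈ (Subtype.val '' E.cells : Set ZOmega) :=
      hτ ▸ ⟨x.1.1, ⟨x.1, x.2, rfl⟩, rfl⟩
    obtain ⟨y, hy, hyx⟩ := this
    exact ⟨⟨y, hy⟩, hyx⟩
  choose f hf using hmem
  have hf' (x : D.cells) (j : ℕ) : (f x).1.1 j = x.1.1 (τ.symm j) := by
    rw [hf, Finsupp.equivMapDomain_apply]
  refine ⟨Equiv.ofBijective f ⟨fun x y hxy => cell_ext fun i => ?_, fun y => ?_⟩,
    fun x y => cell_ext fun j => ?_⟩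
  · have := hf' x (τ i)
    rw [hxy, hf', τ.symm_apply_apply] at this
    exact this.symm
  · have : y.1.1 ∈ (Subtype.val '' E.cells : Set ZOmega) := ⟨y.1, y.2, rfl⟩
    rw [← hτ] at this
    obtain ⟨_, ⟨x, hx, rfl⟩, hxy⟩ := this
    exact ⟨⟨x, hx⟩, Subtype.ext (Subtype.ext ((hf _).trans hxy))⟩
  · change (f (x ⇀ y)).1.1 j = (f x ⇀ f y).1.1 j
    simp only [hf', op_apply]

/-- The finite regular `L`-algebra of a diagram, lifted to an arbitrary universe. -/
noncomputable def toFiniteRegular (D : InfYoungDiagram) : FiniteRegularLAlgebra.{u} where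
  carrier := ULift.{u} D.cells
  finite := by
    have : Finite D.cells := D.finite
    infer_instance
  regular := D.isRegular.uLift

theorem mk_toFiniteRegular_eq_iff (D : InfYoungDiagram) (X : FiniteRegularLAlgebra.{u}) :
    Quotient.mk FiniteRegularLAlgebra.isoSetoid D.toFiniteRegular =
      Quotient.mk FiniteRegularLAlgebra.isoSetoid X ↔ LAlgebra.Isomorphic D.cells X.carrier := by
  have hD : LAlgebra.Isomorphic D.toFiniteRegular.{u}.carrier D.cells :=
    LAlgebra.isomorphic_uLift D.cells
  rw [Quotient.eq]
  exact ⟨fun h => hD.symm.trans h, fun h => hD.trans h⟩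

end InfYoungDiagram

/-- Every infinite-dimensional Young diagram is a finite regular `L`-algebra, and sending a
diagram to its isomorphism class induces a bijection from conjugacy classes of diagrams onto
isomorphism classes of finite regular `L`-algebras (in any universe). -/
theorem mainTheorem2 :
    (∀ D : InfYoungDiagram, Finite D.cells ∧ LAlgebra.IsRegular D.cells) ∧
    ∃ Φ : InfYoungDiagram.ConjClass → FiniteRegularLAlgebra.IsoClass.{u},
      Function.Bijective Φ ∧
      ∀ (D : InfYoungDiagram) (X : FiniteRegularLAlgebra.{u}),
        Φ (Quotient.mk InfYoungDiagram.conjSetoid D) =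
            Quotient.mk FiniteRegularLAlgebra.isoSetoid X ↔
          LAlgebra.Isomorphic D.cells X.carrier := by
  refine ⟨fun D => ⟨D.finite, D.isRegular⟩,
    Quotient.lift (fun D => Quotient.mk FiniteRegularLAlgebra.isoSetoid D.toFiniteRegular)
      fun D E h => ?_, ⟨?_, ?_⟩, InfYoungDiagram.mk_toFiniteRegular_eq_iff⟩
  · exact (InfYoungDiagram.mk_toFiniteRegular_eq_iff D _).2 <|
      (InfYoungDiagram.isomorphic_of_conjugate h).trans (LAlgebra.isomorphic_uLift E.cells).symm
  · rintro ⟨D⟩ ⟨E⟩ h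
    exact Quotient.sound (InfYoungDiagram.conjugate_of_isomorphic
      (((InfYoungDiagram.mk_toFiniteRegular_eq_iff D _).1 h).trans
        (LAlgebra.isomorphic_uLift E.cells)))
  · rintro ⟨X⟩
    have : Finite X.carrier := X.finite
    obtain ⟨D, hD⟩ := InfYoungDiagram.exists_isomorphic X.carrier X.regular
    exact ⟨Quotient.mk InfYoungDiagram.conjSetoid D,
      (InfYoungDiagram.mk_toFiniteRegular_eq_iff D X).2 hD⟩
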